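/- For sets $A\subset X\subset\mathbb R$ let $X_i(A)$, $X_l(A)$, $X_r(A)$ be the set $X$ with the topology that has as a subbase the Euclidean open subsets of $X$ together with, respectively, the singletons $\{x\}$, the sets $X\cap(-\infty,x]$, the sets $X\cap[x,+\infty)$, where $x$ runs over $X\setminus A$. A family $\mathcal S$ of sets is non-Archimedean if any two of its members are disjoint or one of them contains the other. A topological space $Y$ is co-non-Archimedean if there is a non-Archimedean family $\mathcal S$ of subsets of $Y$ such that $\mathcal S\cup\{Y\setminus U: U\in\mathcal S\}$ is a subbase of $Y$ (in particular the members of $\mathcal S$ are clopen). A space $Y$ is Lindelöf to countable degree if the power $Y^{\omega}$ is Lindelöf. There is a partition $\{M_\alpha:\alpha<2^\omega\}$ of $\mathbb R$ into nonempty sets such that $(\mathbb R_i(M_\alpha))^{\omega}$ is Lindelöf for every $\alpha<2^\omega$. Moreover, let $\{M_\alpha:\alpha<2^\omega\}$ be any such partition, let $A$ and $B$ be two different members of it (for example $A=M_0$ and $B=M_1$), and let $C=\mathbb R\setminus(A\cup B)$, $\mathsf L=A\cup C$, $\mathsf R=B\cup C$. Then each of the spaces $\mathsf L_i(A)$, $\mathsf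 L_l(A)$, $\mathsf L_r(A)$, $\mathsf R_i(B)$, $\mathsf R_l(B)$, $\mathsf R_r(B)$ is co-non-Archimedean and Lindelöf to countable degree. -/

import Mathlib

open Set

/-- The topology on `X` having the open sets of `τ` together with the members of `S`
as a subbase. -/
abbrev adjoinOpens {X : Type*} (τ : TopologicalSpace X) (S : Set (Set X)) : TopologicalSpace X :=
  TopologicalSpace.generateFrom ({U : Set X | τ.IsOpen U} ∪ S)

/-- On `X ⊆ ℝ`: the Euclidean topology with every point of `X \ A` made isolated. -/
abbrev isolatingTopology (X A : Set ℝ) : TopologicalSpace X :=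
  adjoinOpens (inferInstance : TopologicalSpace X)
    {U : Set X | ∃ x : X, (x : ℝ) ∉ A ∧ U = {x}}

/-- On `X ⊆ ℝ`: the Euclidean topology with the sets `X ∩ (-∞, x]`, `x ∈ X \ A`, made open. -/
abbrev leftTopology (X A : Set ℝ) : TopologicalSpace X :=
  adjoinOpens (inferInstance : TopologicalSpace X)
    {U : Set X | ∃ x : X, (x : ℝ) ∉ A ∧ U = {y : X | (y : ℝ) ≤ (x : ℝ)}}

/-- On `X ⊆ ℝ`: the Euclidean topology with the sets `X ∩ [x, +∞)`, `x ∈ X \ A`, made open. -/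
abbrev rightTopology (X A : Set ℝ) : TopologicalSpace X :=
  adjoinOpens (inferInstance : TopologicalSpace X)
    {U : Set X | ∃ x : X, (x : ℝ) ∉ A ∧ U = {y : X | (x : ℝ) ≤ (y : ℝ)}}

/-- A family of sets is non-Archimedean if any two of its members are disjoint or comparable. -/
def IsNonArchimedeanFamily {X : Type*} (S : Set (Set X)) : Prop :=
  ∀ U ∈ S, ∀ V ∈ S, Disjoint U V ∨ U ⊆ V ∨ V ⊆ U

/-- A topology is co-non-Archimedean if, for some non-Archimedean family `S` of sets, the members
of `S` together with their complements form a subbase (so the members of `S` are clopen). -/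
def IsCoNonArchimedean {X : Type*} (t : TopologicalSpace X) : Prop :=
  ∃ S : Set (Set X), IsNonArchimedeanFamily S ∧
    t = TopologicalSpace.generateFrom (S ∪ {V : Set X | ∃ U ∈ S, V = Uᶜ})

/-- Lindelöf to countable degree: the countably infinite power, with the product topology,
is Lindelöf. -/
def IsLindelofToCountableDegree {X : Type*} (t : TopologicalSpace X) : Prop :=
  @LindelofSpace (ℕ → X) (@Pi.topologicalSpace ℕ (fun _ => X) (fun _ => t))

/-- `M` is a partition of the real line into nonempty sets such that, for every part `M i`, the
real line with all points outside `M i` made isolated is Lindelöf to countable degree. -/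
def IsLindelofPartition {ι : Type*} (M : ι → Set ℝ) : Prop :=
  (∀ i, (M i).Nonempty) ∧ Pairwise (fun i j => Disjoint (M i) (M j)) ∧
    (⋃ i, M i) = univ ∧
    ∀ i, IsLindelofToCountableDegree (isolatingTopology univ (M i))

/-! Suppose an open cover of the power of `ℝ` with the points outside `M` isolated has no countable
subcover. Sets covered by countably many members form a proper σ-ideal. Repeated splitting of large
sets gives a binary tree of large sets in `ℕ → ℝ`: diameters shrink, coordinate `k` is made constant
or free (all its slices small) at level `k + 1`, and siblings are separated in the coordinates `n ≤
k` that are free. Every branch has a limit point. If its coordinates that never become constant have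
values in `M`, each basic neighbourhood of the limit contains a large set, although the limit lies
in a single member of the cover: a contradiction.

So `M` need only contain the free values of some branch of each such tree. A tree enters only
through its code, a countable array of reals and marks, so there are at most continuum many codes,
and they can be listed before any partition is known. By the separation a real is a free value on
only countably many of the continuum many branches, so transfinite recursion picks disjoint
countable sets of free values, one for each code and each part.

For the six spaces, take `X` containing `A` and missing `B`. Since `B` is dense, cuts at points of
`B` generate the Euclidean topology of `X` and are clopen there. Moreover `X` is closed in the line
with all points outside `A` isolated, and the two ray topologies are coarser than the isolating one.
-/

open scoped Topology
open Filter

/-! ### Transfinite choice of disjoint countable sets -/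

/-- Countable sets `E j z` chosen from fewer than `|Z|`-many earlier ones can be kept disjoint as
soon as each point lies in only countably many of the candidates `E j z`. -/
theorem exists_pairwise_disjoint_choice {J Z α : Type} (hZ : Cardinal.aleph0 < Cardinal.mk Z)
    (hJ : Cardinal.mk J ≤ Cardinal.mk Z) (E : J → Z → Set α) (hE : ∀ j z, (E j z).Countable)
    (hfib : ∀ j r, {z | r ∈ E j z}.Countable) :
    ∃ z : J → Z, Pairwise fun i j => Disjoint (E i (z i)) (E j (z j)) := by
  -- Each point of `W` rules out only countably many `z`, so `W` rules out fewer than `|Z|`.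
  have avoid : ∀ j (W : Set α), Cardinal.mk W < Cardinal.mk Z → ∃ z, Disjoint (E j z) W := by
    intro j W hW
    by_contra! hcon
    have huniv : (⋃ r ∈ W, {z | r ∈ E j z}) = univ := by
      refine eq_univ_of_forall fun z => ?_
      obtain ⟨r, h1, h2⟩ := Set.not_disjoint_iff.1 (hcon z)
      exact mem_biUnion h2 h1
    have hle := Cardinal.mk_biUnion_le (fun r => {z | r ∈ E j z}) W
    rw [huniv, Cardinal.mk_univ] at hle
    refine absurd hle (not_le.2 (lt_of_le_of_lt ?_
      (Cardinal.mul_lt_of_lt hZ.le hW hZ)))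
    gcongr
    exact ciSup_le' fun r => (hfib j r).le_aleph0
  have : ∀ j (W : Set α), ∃ z, Cardinal.mk W < Cardinal.mk Z → Disjoint (E j z) W := by
    intro j W
    by_cases hW : Cardinal.mk W < Cardinal.mk Z
    · exact (avoid j W hW).imp fun _ h _ => h
    · have : Nonempty Z := Cardinal.mk_ne_zero_iff.1 (Cardinal.aleph0_pos.trans hZ).ne'
      exact ⟨Classical.arbitrary Z, fun h => absurd h hW⟩
  choose F hF using this
  -- A well-order of least type: proper initial segments have cardinality below `|J|`.
  obtain ⟨o, wf, ho⟩ := Cardinal.exists_ord_eq_type_lt J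
  let z : J → Z := wellFounded_lt.fix fun j ih => F j (⋃ i : Iio j, E i (ih i i.2))
  have hz : ∀ j, z j = F j (⋃ i : Iio j, E i (z i)) := fun j => wellFounded_lt.fix_eq _ j
  have key : ∀ j, Disjoint (E j (z j)) (⋃ i : Iio j, E i (z i)) := by
    intro j
    have hIio : Cardinal.mk (Iio j) < Cardinal.mk J := Cardinal.mk_Iio_lt j ho
    have hmain := hF j (⋃ i : Iio j, E i (z i)) ?_
    · rwa [← hz] at hmain
    · refine (Cardinal.mk_iUnion_le _).trans_lt (lt_of_le_of_lt ?_
        (Cardinal.mul_lt_of_lt hZ.le (hIio.trans_le hJ) hZ))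
      gcongr
      exact ciSup_le' fun i => (hE _ _).le_aleph0
  refine ⟨z, fun i j hij => ?_⟩
  rcases lt_or_gt_of_ne hij with h | h
  · exact ((key j).mono_right (subset_iUnion (fun i : Iio j => E i (z i)) ⟨i, h⟩)).symm
  · exact (key i).mono_right (subset_iUnion (fun j : Iio i => E j (z j)) ⟨j, h⟩)

/-- There is a partition indexed by `K` all of whose parts meet every requirement `E t`. -/
theorem exists_partition_forall_exists_subset {T K Z α : Type} [Nonempty K]
    (hZ : Cardinal.aleph0 < Cardinal.mk Z) (hT : Cardinal.mk T ≤ Cardinal.mk Z)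
    (hK : Cardinal.mk K ≤ Cardinal.mk Z) (E : T → Z → Set α) (hE : ∀ t z, (E t z).Countable)
    (hfib : ∀ t r, {z | r ∈ E t z}.Countable) :
    ∃ M : K → Set α, (Pairwise fun i j => Disjoint (M i) (M j)) ∧ (⋃ i, M i) = univ ∧
      ∀ t i, ∃ z, E t z ⊆ M i := by
  classical
  obtain ⟨z, hz⟩ := exists_pairwise_disjoint_choice (J := T × K) hZ
    (by
      rw [Cardinal.mk_prod, Cardinal.lift_id, Cardinal.lift_id]
      exact (mul_le_mul' hT hK).trans (Cardinal.mul_eq_self hZ.le).le)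
    (fun j => E j.1) (fun j => hE j.1) (fun j => hfib j.1)
  let N : K → Set α := fun i => ⋃ t, E t (z (t, i))
  let k₀ : K := Classical.arbitrary K
  have hN : Pairwise fun i j => Disjoint (N i) (N j) := by
    intro i j hij
    simp only [N, disjoint_iUnion_left, disjoint_iUnion_right]
    exact fun t s => hz (i := (_, i)) (j := (_, j)) (fun h => hij (congrArg Prod.snd h))
  -- The points left over all go to the part `k₀`.
  refine ⟨fun i => N i ∪ {r | i = k₀ ∧ ∀ j, r ∉ N j}, fun i j hij => ?_, ?_, fun t i => ?_⟩
  · refine Set.disjoint_left.2 ?_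
    rintro r (h1 | h1) (h2 | h2)
    · exact Set.disjoint_left.1 (hN hij) h1 h2
    · exact h2.2 _ h1
    · exact h1.2 _ h2
    · exact hij (h1.1.trans h2.1.symm)
  · refine eq_univ_of_forall fun r => ?_
    by_cases h : ∃ j, r ∈ N j
    · obtain ⟨j, hj⟩ := h
      exact mem_iUnion.2 ⟨j, Or.inl hj⟩
    · exact mem_iUnion.2 ⟨k₀, Or.inr ⟨rfl, not_exists.1 h⟩⟩
  · exact ⟨z (t, i), (subset_iUnion (fun t => E t (z (t, i))) t).trans subset_union_left⟩

/-! ### σ-ideals and the splitting of large sets -/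

/-- `Small` is a σ-ideal of subsets of `α`. -/
structure IsSigmaIdeal {α : Type*} (Small : Set α → Prop) : Prop where
  mono : ∀ {s t : Set α}, s ⊆ t → Small t → Small s
  sUnion : ∀ {S : Set (Set α)}, S.Countable → (∀ s ∈ S, Small s) → Small (⋃₀ S)

theorem IsSigmaIdeal.union {α : Type*} {Small : Set α → Prop} (h : IsSigmaIdeal Small)
    {s t : Set α} (hs : Small s) (ht : Small t) : Small (s ∪ t) := by
  rw [← sUnion_pair]
  exact h.sUnion ((countable_singleton t).insert s) (by simp [hs, ht])

theorem IsSigmaIdeal.iUnion {α κ : Type*} [Countable κ] {Small : Set α → Prop}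
    (h : IsSigmaIdeal Small) {s : κ → Set α} (hs : ∀ i, Small (s i)) : Small (⋃ i, s i) := by
  rw [← sUnion_range]
  exact h.sUnion (countable_range s) (by simpa using hs)

/-- The points of `N` having a neighbourhood in which `N` is small form a small set. -/
theorem IsSigmaIdeal.small_setOf_locally_small {α : Type*} [TopologicalSpace α]
    [SecondCountableTopology α] {Small : Set α → Prop} (h : IsSigmaIdeal Small) (N : Set α) :
    Small {x ∈ N | ∃ V ∈ 𝓝 x, Small (N ∩ V)} := by
  let b := TopologicalSpace.countableBasis α
  have hb := TopologicalSpace.isBasis_countableBasis α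
  refine h.mono (t := ⋃₀ ((fun V => N ∩ V) '' {V ∈ b | Small (N ∩ V)})) ?_
    (h.sUnion (((TopologicalSpace.countable_countableBasis α).mono (sep_subset _ _)).image _) ?_)
  · rintro x ⟨hx, V, hV, hs⟩
    obtain ⟨W, hW, hxW, hWV⟩ := hb.mem_nhds_iff.1 hV
    exact ⟨_, ⟨W, ⟨hW, h.mono (inter_subset_inter_right _ hWV) hs⟩, rfl⟩, hx, hxW⟩
  · rintro _ ⟨V, hV, rfl⟩
    exact hV.2

/-- The `n`-th coordinate is constant on `N`. -/
def ConstAt (N : Set (ℕ → ℝ)) (n : ℕ) : Prop := ∀ x ∈ N, ∀ y ∈ N, x n = y n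

/-- Fixing the `n`-th coordinate makes `N` small. -/
def FreeAt (Small : Set (ℕ → ℝ) → Prop) (N : Set (ℕ → ℝ)) (n : ℕ) : Prop :=
  ∀ r, Small (N ∩ {x | x n = r})

theorem ConstAt.mono {N N' : Set (ℕ → ℝ)} {n : ℕ} (hN : ConstAt N n) (h : N' ⊆ N) :
    ConstAt N' n := fun x hx y hy => hN x (h hx) y (h hy)

theorem FreeAt.mono {Small : Set (ℕ → ℝ) → Prop} (hS : IsSigmaIdeal Small)
    {N N' : Set (ℕ → ℝ)} {n : ℕ} (hN : FreeAt Small N n) (h : N' ⊆ N) : FreeAt Small N' n :=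
  fun r => hS.mono (inter_subset_inter_left _ h) (hN r)

theorem exists_constAt_or_freeAt {Small : Set (ℕ → ℝ) → Prop}
    {N : Set (ℕ → ℝ)} (hN : ¬ Small N) (n : ℕ) :
    ∃ N' ⊆ N, ¬ Small N' ∧ (ConstAt N' n ∨ FreeAt Small N' n) := by
  by_cases h : FreeAt Small N n
  · exact ⟨N, subset_rfl, hN, Or.inr h⟩
  · obtain ⟨r, hr⟩ := not_forall.1 h
    exact ⟨_, inter_subset_left, hr, Or.inl fun x hx y hy => hx.2.trans hy.2.symm⟩

/-- A large set has two large subsets, of small diameter in the first coordinates and separated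
in those of them that are free. -/
theorem exists_separated_large_subsets {Small : Set (ℕ → ℝ) → Prop} (hS : IsSigmaIdeal Small)
    {N : Set (ℕ → ℝ)} (hN : ¬ Small N) (k : ℕ) :
    ∃ N' : Bool → Set (ℕ → ℝ), (∀ b, N' b ⊆ N ∧ ¬ Small (N' b) ∧
        (∀ x ∈ N' b, ∀ y ∈ N' b, ∀ n ≤ k, |x n - y n| ≤ (1 / 2) ^ k) ∧
        (ConstAt (N' b) k ∨ FreeAt Small (N' b) k)) ∧
      ∀ n ≤ k, FreeAt Small N n → ∃ ε > 0, ∀ x ∈ N' true, ∀ y ∈ N' false, ε ≤ |x n - y n| := by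
  let T : Set (ℕ → ℝ) := {x ∈ N | ∃ V ∈ 𝓝 x, Small (N ∩ V)}
  have hT : Small T := hS.small_setOf_locally_small N
  have hpick : ∀ s : Set (ℕ → ℝ), Small s → ∃ p ∈ N, p ∉ s ∧ ∀ V ∈ 𝓝 p, ¬ Small (N ∩ V) := by
    intro s hs
    by_contra! hcon
    refine hN (hS.mono (fun x hx => ?_) (hS.union hs hT))
    by_cases hxs : x ∈ s
    · exact Or.inl hxs
    · exact Or.inr ⟨hx, hcon x hx hxs⟩
  obtain ⟨p, hpN, -, hp⟩ := hpick ∅ (hS.mono (empty_subset _) hT)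
  -- The slices of `N` through `p` in free coordinates are countably many small sets; avoiding them
  -- makes `q` differ from `p` in every free coordinate.
  obtain ⟨q, hqN, hqp, hq⟩ := hpick (⋃ n : {n : ℕ // FreeAt Small N n}, N ∩ {x | x n = p n})
    (hS.iUnion fun n => n.2 _)
  have hne : ∀ n, FreeAt Small N n → p n ≠ q n := fun n hn h =>
    hqp (mem_iUnion.2 ⟨⟨n, hn⟩, hqN, h.symm⟩)
  -- `2 * δ` bounds the diameter of each piece, and of a gap `3 * δ` between `p` and `q` at least
  -- `δ` survives.
  obtain ⟨δ, hδ, hδk, hδs⟩ : ∃ δ > 0, δ ≤ (1 / 2 : ℝ) ^ k / 2 ∧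
      ∀ n ≤ k, FreeAt Small N n → 3 * δ ≤ |p n - q n| := by
    have h1 : ∀ c > 0, ∀ᶠ δ in 𝓝[>] (0 : ℝ), δ < c := fun c hc =>
      nhdsWithin_le_nhds (gt_mem_nhds hc)
    have h2 : ∀ᶠ δ in 𝓝[>] (0 : ℝ), ∀ n ∈ Iic k, FreeAt Small N n → 3 * δ ≤ |p n - q n| := by
      refine (eventually_all_finite (finite_Iic k)).2 fun n _ => ?_
      by_cases hn : FreeAt Small N n
      · filter_upwards [h1 (|p n - q n| / 3) (by
          have := abs_pos.2 (sub_ne_zero.2 (hne n hn))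
          positivity)] with δ hδ _
        linarith
      · exact Eventually.of_forall fun _ h => absurd h hn
    obtain ⟨δ, ⟨h3, h4⟩, h5⟩ := ((h1 ((1 / 2 : ℝ) ^ k / 2) (by positivity)).and h2
      |>.and self_mem_nhdsWithin).exists
    exact ⟨δ, h5, h3.le, h4⟩
  let V : (ℕ → ℝ) → Set (ℕ → ℝ) := fun p => {x | ∀ n ∈ Iic k, |x n - p n| < δ}
  have hV : ∀ p, V p ∈ 𝓝 p := fun p => by
    refine (eventually_all_finite (finite_Iic k)).2 fun n _ => ?_
    exact (continuous_apply n).continuousAt.eventually (Metric.ball_mem_nhds (p n) hδ)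
  choose P hPsub hPlarge hPdec using fun b : Bool =>
    exists_constAt_or_freeAt (N := N ∩ V (bif b then p else q))
      (by cases b; exacts [hq _ (hV q), hp _ (hV p)]) k
  refine ⟨P, fun b => ⟨(hPsub b).trans inter_subset_left, hPlarge b, fun x hx y hy n hn => ?_,
    hPdec b⟩, fun n hn hfree => ⟨δ, hδ, fun x hx y hy => ?_⟩⟩
  · have h1 := abs_lt.1 ((hPsub b hx).2 n hn)
    have h2 := abs_lt.1 ((hPsub b hy).2 n hn)
    rw [abs_le]
    constructor <;> linarith
  · have h1 : |x n - p n| < δ := (hPsub true hx).2 n hn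
    have h2 : |y n - q n| < δ := (hPsub false hy).2 n hn
    have h3 := hδs n hn hfree
    have h4 : |p n - q n| ≤ |x n - p n| + |x n - y n| + |y n - q n| := by
      rw [abs_sub_comm (x n) (p n)]
      calc |p n - q n| = |(p n - x n) + (x n - y n) + (y n - q n)| := by ring_nf
        _ ≤ _ := abs_add_three _ _ _
    linarith

/-! ### Binary trees of large sets, their codes and limits -/

/-- The first `k` terms of a branch, latest first. -/
def branchPrefix (z : ℕ → Bool) : ℕ → List Bool
  | 0 => []
  | k + 1 => z k :: branchPrefix z k

@[simp]
theorem length_branchPrefix (z : ℕ → Bool) (k : ℕ) : (branchPrefix z k).length = k := by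
  induction k with
  | zero => rfl
  | succ k ih => simp [branchPrefix, ih]

theorem exists_branchPrefix_eq_and_ne {z z' : ℕ → Bool} (h : z ≠ z') :
    ∃ m, branchPrefix z m = branchPrefix z' m ∧ z m ≠ z' m := by
  classical
  have hex : ∃ m, z m ≠ z' m := Function.ne_iff.1 h
  refine ⟨Nat.find hex, ?_, Nat.find_spec hex⟩
  have : ∀ m ≤ Nat.find hex, branchPrefix z m = branchPrefix z' m := by
    intro m
    induction m with
    | zero => exact fun _ => rfl
    | succ m ih =>
      intro hm
      rw [branchPrefix, branchPrefix, ih (by omega), not_not.1 (Nat.find_min hex hm)]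
  exact this _ le_rfl

/-- The values of the limit along the branch `z` in the coordinates never marked as constant. -/
noncomputable def freeValues (g : List Bool → ℕ → ℝ × Bool) (z : ℕ → Bool) : Set ℝ :=
  {r | ∃ n, (∀ k, (g (branchPrefix z k) n).2 = false) ∧
    limUnder atTop (fun k => (g (branchPrefix z k) n).1) = r}

theorem countable_freeValues (g : List Bool → ℕ → ℝ × Bool) (z : ℕ → Bool) :
    (freeValues g z).Countable :=
  (countable_range fun n => limUnder atTop (fun k => (g (branchPrefix z k) n).1)).mono <| by
    rintro r ⟨n, -, h⟩
    exact ⟨n, h⟩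

section Scheme

variable {Small : Set (ℕ → ℝ) → Prop} (hS : IsSigmaIdeal Small) (h₀ : ¬ Small univ)

/-- The tree of large sets obtained by iterating `exists_separated_large_subsets`. -/
noncomputable def largeScheme : List Bool → {N : Set (ℕ → ℝ) // ¬ Small N}
  | [] => ⟨univ, h₀⟩
  | b :: σ => ⟨(exists_separated_large_subsets hS (largeScheme σ).2 σ.length).choose b,
      ((exists_separated_large_subsets hS (largeScheme σ).2 σ.length).choose_spec.1 b).2.1⟩

theorem largeScheme_cons_subset (b : Bool) (σ : List Bool) :
    (largeScheme hS h₀ (b :: σ)).1 ⊆ (largeScheme hS h₀ σ).1 :=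
  ((exists_separated_large_subsets hS (largeScheme hS h₀ σ).2 σ.length).choose_spec.1 b).1

theorem abs_sub_le_of_mem_largeScheme {b : Bool} {σ : List Bool} {x y : ℕ → ℝ}
    (hx : x ∈ (largeScheme hS h₀ (b :: σ)).1) (hy : y ∈ (largeScheme hS h₀ (b :: σ)).1)
    {n : ℕ} (hn : n ≤ σ.length) : |x n - y n| ≤ (1 / 2) ^ σ.length :=
  ((exists_separated_large_subsets hS (largeScheme hS h₀ σ).2 σ.length).choose_spec.1
    b).2.2.1 x hx y hy n hn

theorem constAt_or_freeAt_largeScheme (b : Bool) (σ : List Bool) :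
    ConstAt (largeScheme hS h₀ (b :: σ)).1 σ.length ∨
      FreeAt Small (largeScheme hS h₀ (b :: σ)).1 σ.length :=
  ((exists_separated_large_subsets hS (largeScheme hS h₀ σ).2 σ.length).choose_spec.1 b).2.2.2

theorem exists_le_abs_sub_of_mem_largeScheme {σ : List Bool} {n : ℕ} (hn : n ≤ σ.length)
    (hfree : FreeAt Small (largeScheme hS h₀ σ).1 n) :
    ∃ ε > 0, ∀ x ∈ (largeScheme hS h₀ (true :: σ)).1,
      ∀ y ∈ (largeScheme hS h₀ (false :: σ)).1, ε ≤ |x n - y n| :=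
  (exists_separated_large_subsets hS (largeScheme hS h₀ σ).2 σ.length).choose_spec.2 n hn hfree

theorem largeScheme_branch_antitone (z : ℕ → Bool) :
    Antitone fun k => (largeScheme hS h₀ (branchPrefix z k)).1 :=
  antitone_nat_of_succ_le fun k => largeScheme_cons_subset hS h₀ (z k) (branchPrefix z k)

theorem IsSigmaIdeal.nonempty_of_not {α : Type*} {Small : Set α → Prop} (h : IsSigmaIdeal Small)
    {N : Set α} (hN : ¬ Small N) : N.Nonempty := by
  rw [nonempty_iff_ne_empty]
  rintro rfl
  exact hN (by simpa using h.sUnion (S := ∅) countable_empty (by simp))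

/-- Points of the members of the scheme, with marks for the constant coordinates. -/
noncomputable def schemeCode (σ : List Bool) (n : ℕ) : ℝ × Bool :=
  open Classical in
  ((hS.nonempty_of_not (largeScheme hS h₀ σ).2).choose n,
    decide (ConstAt (largeScheme hS h₀ σ).1 n))

theorem schemeCode_mem (σ : List Bool) :
    (fun n => (schemeCode hS h₀ σ n).1) ∈ (largeScheme hS h₀ σ).1 :=
  (hS.nonempty_of_not (largeScheme hS h₀ σ).2).choose_spec

theorem schemeCode_snd_eq_false {σ : List Bool} {n : ℕ} :
    (schemeCode hS h₀ σ n).2 = false ↔ ¬ ConstAt (largeScheme hS h₀ σ).1 n := by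
  simp [schemeCode]

/-- The limit of the scheme along a branch. -/
noncomputable def branchLimit (z : ℕ → Bool) (n : ℕ) : ℝ :=
  limUnder atTop (fun k => (schemeCode hS h₀ (branchPrefix z k) n).1)

theorem tendsto_branchLimit (z : ℕ → Bool) (n : ℕ) :
    Tendsto (fun k => (schemeCode hS h₀ (branchPrefix z k) n).1) atTop
      (𝓝 (branchLimit hS h₀ z n)) := by
  refine CauchySeq.tendsto_limUnder (Metric.cauchySeq_iff'.2 fun ε hε => ?_)
  obtain ⟨m, hm⟩ := exists_pow_lt_of_lt_one hε (by norm_num : (1 / 2 : ℝ) < 1)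
  -- `m` gives the precision; `n ≤ k` is needed because level `k + 1` controls only the coordinates
  -- up to `k`.
  let k := max m n
  refine ⟨k + 1, fun j hj => ?_⟩
  have h1 := abs_sub_le_of_mem_largeScheme hS h₀ (b := z k) (σ := branchPrefix z k)
    (largeScheme_branch_antitone hS h₀ z hj (schemeCode_mem hS h₀ (branchPrefix z j)))
    (schemeCode_mem hS h₀ (branchPrefix z (k + 1))) (n := n) (by simp [k])
  rw [length_branchPrefix] at h1
  refine lt_of_le_of_lt h1 (lt_of_le_of_lt ?_ hm)
  exact pow_le_pow_of_le_one (by norm_num) (by norm_num) (le_max_left _ _)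

theorem abs_sub_branchLimit_le (z : ℕ → Bool) {n k : ℕ} (hn : n ≤ k) {y : ℕ → ℝ}
    (hy : y ∈ (largeScheme hS h₀ (branchPrefix z (k + 1))).1) :
    |y n - branchLimit hS h₀ z n| ≤ (1 / 2) ^ k := by
  refine le_of_tendsto ((tendsto_const_nhds.sub (tendsto_branchLimit hS h₀ z n)).abs)
    (eventually_atTop.2 ⟨k + 1, fun j hj => ?_⟩)
  have h1 := abs_sub_le_of_mem_largeScheme hS h₀ (b := z k) (σ := branchPrefix z k) hy
    (largeScheme_branch_antitone hS h₀ z hj (schemeCode_mem hS h₀ (branchPrefix z j)))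
    (n := n) (by simpa using hn)
  rwa [length_branchPrefix] at h1

theorem eq_branchLimit_of_constAt (z : ℕ → Bool) {n k : ℕ}
    (hc : ConstAt (largeScheme hS h₀ (branchPrefix z k)).1 n) {y : ℕ → ℝ}
    (hy : y ∈ (largeScheme hS h₀ (branchPrefix z k)).1) : y n = branchLimit hS h₀ z n := by
  refine tendsto_nhds_unique (tendsto_const_nhds.congr' ?_) (tendsto_branchLimit hS h₀ z n)
  exact eventually_atTop.2 ⟨k, fun j hj => hc _ hy _
    (largeScheme_branch_antitone hS h₀ z hj (schemeCode_mem hS h₀ (branchPrefix z j)))⟩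

theorem branchLimit_ne_branchLimit {z z' : ℕ → Bool} {m n : ℕ} (hn : n ≤ m)
    (hfree : FreeAt Small (largeScheme hS h₀ (branchPrefix z m)).1 n)
    (heq : branchPrefix z m = branchPrefix z' m) (ht : z m = true) (hf : z' m = false) :
    branchLimit hS h₀ z n ≠ branchLimit hS h₀ z' n := by
  obtain ⟨ε, hε, hsep⟩ := exists_le_abs_sub_of_mem_largeScheme hS h₀ (by simpa using hn) hfree
  have hle : ε ≤ |branchLimit hS h₀ z n - branchLimit hS h₀ z' n| := by
    refine ge_of_tendsto
      (((tendsto_branchLimit hS h₀ z n).sub (tendsto_branchLimit hS h₀ z' n)).abs)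
      (eventually_atTop.2 ⟨m + 1, fun j hj =>
        hsep (fun n => (schemeCode hS h₀ (branchPrefix z j) n).1) ?_
          (fun n => (schemeCode hS h₀ (branchPrefix z' j) n).1) ?_⟩)
    · have := largeScheme_branch_antitone hS h₀ z hj (schemeCode_mem hS h₀ (branchPrefix z j))
      simpa only [branchPrefix, ht] using this
    · have := largeScheme_branch_antitone hS h₀ z' hj (schemeCode_mem hS h₀ (branchPrefix z' j))
      simpa only [branchPrefix, hf, heq] using this
  intro h
  rw [h, sub_self, abs_zero] at hle
  exact absurd hle hε.not_ge

/-- Fix the coordinate `n`. Two branches with a common prefix of length `n + 1` split only after `n`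
has been declared free, so their limits differ there. Hence the prefix, taken from a countable set,
determines the branch. -/
theorem countable_setOf_mem_freeValues_schemeCode (r : ℝ) :
    {z | r ∈ freeValues (schemeCode hS h₀) z}.Countable := by
  have : {z | r ∈ freeValues (schemeCode hS h₀) z} ⊆ ⋃ n, {z |
      (∀ k, (schemeCode hS h₀ (branchPrefix z k) n).2 = false) ∧ branchLimit hS h₀ z n = r} :=
    fun z ⟨n, h⟩ => mem_iUnion.2 ⟨n, h⟩
  refine (countable_iUnion fun n => ?_).mono this
  refine MapsTo.countable_of_injOn (mapsTo_univ (fun z => branchPrefix z (n + 1)) _) ?_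
    (to_countable _)
  rintro z ⟨hz, hzr⟩ z' ⟨hz', hzr'⟩ (hpre : branchPrefix z (n + 1) = branchPrefix z' (n + 1))
  by_contra hne
  obtain ⟨m, hm, hmne⟩ := exists_branchPrefix_eq_and_ne hne
  have hnm : n + 1 ≤ m := by
    by_contra! hlt
    have aux : ∀ j, m < j → branchPrefix z j = branchPrefix z' j → z m = z' m := by
      intro j
      induction j with
      | zero => exact fun h => absurd h (Nat.not_lt_zero _)
      | succ j ih =>
        intro hj h
        rw [branchPrefix, branchPrefix, List.cons.injEq] at h
        rcases Nat.lt_succ_iff_lt_or_eq.1 hj with h' | rfl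
        exacts [ih h' h.2, h.1]
    exact hmne (aux _ hlt hpre)
  have hfree : ∀ w : ℕ → Bool, (∀ k, (schemeCode hS h₀ (branchPrefix w k) n).2 = false) →
      FreeAt Small (largeScheme hS h₀ (branchPrefix w m)).1 n := by
    intro w hw
    have h1 := constAt_or_freeAt_largeScheme hS h₀ (w n) (branchPrefix w n)
    rw [length_branchPrefix] at h1
    exact (h1.resolve_left ((schemeCode_snd_eq_false hS h₀).1 (hw (n + 1)))).mono hS
      (largeScheme_branch_antitone hS h₀ w hnm)
  cases h1 : z m <;> cases h2 : z' m
  · exact hmne (h1.trans h2.symm)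
  · exact branchLimit_ne_branchLimit hS h₀ (by omega) (hfree z' hz') hm.symm h2 h1
      (hzr'.trans hzr.symm)
  · exact branchLimit_ne_branchLimit hS h₀ (by omega) (hfree z hz) hm h1 h2
      (hzr.trans hzr'.symm)
  · exact hmne (h1.trans h2.symm)

/-- If the free values along a branch lie in `M`, then all basic neighbourhoods of the limit, for
the topology isolating the points outside `M`, are large. -/
theorem not_small_nhd_branchLimit {M : Set ℝ} {z : ℕ → Bool}
    (hM : freeValues (schemeCode hS h₀) z ⊆ M) (K : ℕ) {ε : ℝ} (hε : 0 < ε) :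
    ¬ Small {y | ∀ n < K, |y n - branchLimit hS h₀ z n| < ε ∧
      (branchLimit hS h₀ z n ∉ M → y n = branchLimit hS h₀ z n)} := by
  obtain ⟨m, hm⟩ := exists_pow_lt_of_lt_one hε (by norm_num : (1 / 2 : ℝ) < 1)
  have h1 : ∀ᶠ k in atTop, ∀ n ∈ Iio K, branchLimit hS h₀ z n ∉ M →
      ∀ y ∈ (largeScheme hS h₀ (branchPrefix z k)).1, y n = branchLimit hS h₀ z n := by
    refine (eventually_all_finite (finite_Iio K)).2 fun n _ => ?_
    by_cases hn : branchLimit hS h₀ z n ∈ M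
    · exact Eventually.of_forall fun _ h => absurd hn h
    -- A coordinate never constant would give a free value, hence a value in `M`.
    · have : ∃ k, ConstAt (largeScheme hS h₀ (branchPrefix z k)).1 n := by
        by_contra! hcon
        exact hn (hM ⟨n, fun k => (schemeCode_snd_eq_false hS h₀).2 (hcon k), rfl⟩)
      obtain ⟨k, hk⟩ := this
      exact eventually_atTop.2 ⟨k, fun j hj _ y hy => eq_branchLimit_of_constAt hS h₀ z hk
        (largeScheme_branch_antitone hS h₀ z hj hy)⟩
  obtain ⟨k, hk, hkm⟩ := (h1.and (eventually_ge_atTop (max m K))).exists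
  refine fun hsmall => (largeScheme hS h₀ (branchPrefix z (k + 1))).2
    (hS.mono ?_ hsmall)
  intro y hy n hn
  refine ⟨?_, fun hnM => ?_⟩
  · refine (abs_sub_branchLimit_le hS h₀ z (hn.le.trans ((le_max_right _ _).trans hkm)) hy).trans_lt
      (lt_of_le_of_lt ?_ hm)
    exact pow_le_pow_of_le_one (by norm_num) (by norm_num) ((le_max_left _ _).trans hkm)
  · exact hk n hn hnM y (largeScheme_branch_antitone hS h₀ z (Nat.le_succ k) hy)

end Scheme

/-! ### Lindelöf powers and the isolating topology -/

theorem IsLindelofToCountableDegree.lindelofSpace {X : Type*} {t : TopologicalSpace X}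
    (h : IsLindelofToCountableDegree t) : LindelofSpace X := by
  have : LindelofSpace (ℕ → X) := h
  exact LindelofSpace.of_continuous_surjective (continuous_apply 0)
    (fun x => ⟨fun _ => x, rfl⟩)

theorem IsLindelofToCountableDegree.mono {X : Type*} {t s : TopologicalSpace X} (hts : t ≤ s)
    (h : IsLindelofToCountableDegree t) : IsLindelofToCountableDegree s := by
  have : @Continuous _ _ (@Pi.topologicalSpace ℕ (fun _ => X) fun _ => t)
      (@Pi.topologicalSpace ℕ (fun _ => X) fun _ => s) id :=
    continuous_id_of_le (iInf_mono fun i => induced_mono hts)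
  exact @LindelofSpace.of_continuous_surjective _ _ (@Pi.topologicalSpace ℕ (fun _ => X) fun _ => t)
      (@Pi.topologicalSpace ℕ (fun _ => X) fun _ => s) id h this Function.surjective_id

theorem IsLindelofToCountableDegree.of_isClosedEmbedding {X Y : Type*} [t : TopologicalSpace X]
    [s : TopologicalSpace Y] {f : X → Y} (hf : Topology.IsClosedEmbedding f)
    (h : IsLindelofToCountableDegree s) : IsLindelofToCountableDegree t := by
  have : LindelofSpace (ℕ → Y) := h
  have hF : Topology.IsClosedEmbedding (Pi.map fun _ : ℕ => f) := by
    refine ⟨Topology.IsEmbedding.piMap fun _ => hf.isEmbedding, ?_⟩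
    rw [Set.range_piMap]
    exact isClosed_set_pi fun _ _ => hf.isClosed_range
  exact hF.LindelofSpace

theorem isOpen_isolatingTopology_iff {X A : Set ℝ} {U : Set X} :
    IsOpen[isolatingTopology X A] U ↔
      ∀ x ∈ U, (x : ℝ) ∈ A → ∃ ε > 0, ∀ y : X, |(y : ℝ) - x| < ε → y ∈ U := by
  constructor
  · intro h
    induction h with
    | basic s hs =>
      intro x hx hxA
      rcases hs with hs | ⟨y, hy, rfl⟩
      · have hs' : IsOpen s := hs
        obtain ⟨ε, hε, h⟩ := Metric.isOpen_iff.1 hs' x hx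
        exact ⟨ε, hε, fun y hy => h hy⟩
      · rw [mem_singleton_iff.1 hx] at hxA
        exact absurd hxA hy
    | univ => exact fun x _ _ => ⟨1, one_pos, fun _ _ => trivial⟩
    | inter s t _ _ h1 h2 =>
      intro x hx hxA
      obtain ⟨ε, hε, h⟩ := h1 x hx.1 hxA
      obtain ⟨δ, hδ, h'⟩ := h2 x hx.2 hxA
      exact ⟨min ε δ, lt_min hε hδ, fun y hy =>
        ⟨h y (hy.trans_le (min_le_left _ _)), h' y (hy.trans_le (min_le_right _ _))⟩⟩
    | sUnion S _ h =>
      rintro x ⟨s, hs, hx⟩ hxA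
      obtain ⟨ε, hε, h⟩ := h s hs x hx hxA
      exact ⟨ε, hε, fun y hy => ⟨s, hs, h y hy⟩⟩
  · intro h
    -- Recorded while `IsOpen` still refers to the Euclidean topology.
    have hball : ∀ (x : X) (ε : ℝ), IsOpen (Metric.ball x ε) := fun x ε => Metric.isOpen_ball
    let := isolatingTopology X A
    refine isOpen_iff_forall_mem_open.2 fun x hx => ?_
    by_cases hxA : (x : ℝ) ∈ A
    · obtain ⟨ε, hε, h⟩ := h x hx hxA
      exact ⟨Metric.ball x ε, fun y hy => h y hy,
        TopologicalSpace.isOpen_generateFrom_of_mem (Or.inl (hball x ε)),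
        Metric.mem_ball_self hε⟩
    · exact ⟨{x}, by simpa using hx,
        TopologicalSpace.isOpen_generateFrom_of_mem (Or.inr ⟨x, hxA, rfl⟩), rfl⟩

/-- A closed interval missing `A` would be an uncountable closed discrete subset of a Lindelöf
space. -/
theorem dense_of_isLindelofToCountableDegree {A : Set ℝ}
    (h : IsLindelofToCountableDegree (isolatingTopology univ A)) : Dense A := by
  rw [dense_iff_inter_open]
  intro U hU hne
  by_contra hcon
  have hA : ∀ x ∈ U, x ∉ A := fun x hx hxA => hcon ⟨x, hx, hxA⟩
  obtain ⟨x, hx⟩ := hne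
  obtain ⟨ε, hε, hball⟩ := Metric.isOpen_iff.1 hU x hx
  let F : Set (univ : Set ℝ) := Subtype.val ⁻¹' Metric.closedBall x (ε / 2)
  have hFA : ∀ y ∈ F, (y : ℝ) ∉ A := fun y hy =>
    hA _ (hball (Metric.closedBall_subset_ball (half_lt_self hε) hy))
  have hFE : IsOpen Fᶜ :=
    (Metric.isClosed_closedBall.preimage continuous_subtype_val).isOpen_compl
  let : TopologicalSpace (univ : Set ℝ) := isolatingTopology univ A
  have : LindelofSpace (univ : Set ℝ) := h.lindelofSpace
  have hF : IsClosed F :=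
    isOpen_compl_iff.1 (TopologicalSpace.isOpen_generateFrom_of_mem (Or.inl hFE))
  have hdisc : DiscreteTopology F := by
    refine discreteTopology_iff_isOpen_singleton.2 fun y => ?_
    have : IsOpen ({(y : (univ : Set ℝ))} : Set (univ : Set ℝ)) :=
      TopologicalSpace.isOpen_generateFrom_of_mem (Or.inr ⟨y, hFA y y.2, rfl⟩)
    convert this.preimage (continuous_subtype_val (p := (· ∈ F))) using 1
    ext w
    simp [Subtype.ext_iff]
  have hcount : F.Countable := hF.isLindelof.countable hdisc
  have : (Metric.closedBall x (ε / 2)).Countable := by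
    refine (hcount.image Subtype.val).mono fun y hy => ?_
    exact ⟨⟨y, trivial⟩, hy, rfl⟩
  rw [Real.closedBall_eq_Icc] at this
  exact Cardinal.Real.Icc_countable_iff.1 this |>.not_gt (by linarith)

/-- Points outside `X` lie outside `A` and are isolated, so `X` is a closed subspace. -/
theorem isLindelofToCountableDegree_isolating_of_subset {X A : Set ℝ} (hA : A ⊆ X)
    (h : IsLindelofToCountableDegree (isolatingTopology univ A)) :
    IsLindelofToCountableDegree (isolatingTopology X A) := by
  let : TopologicalSpace (univ : Set ℝ) := isolatingTopology univ A
  let : TopologicalSpace X := isolatingTopology X A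
  have hf : Topology.IsClosedEmbedding (fun x : X => (⟨x, trivial⟩ : (univ : Set ℝ))) := by
    refine ⟨⟨⟨?_⟩, fun x y hxy => 
      Subtype.ext (congrArg (fun w : (univ : Set ℝ) => (w : ℝ)) hxy)⟩, ?_⟩
    · refine le_antisymm (continuous_iff_le_induced.1 (continuous_def.2 fun U hU => ?_)) ?_
      · rw [isOpen_isolatingTopology_iff] at hU ⊢
        intro x hx hxA
        obtain ⟨ε, hε, h⟩ := hU _ hx hxA
        exact ⟨ε, hε, fun y hy => h _ hy⟩
      · refine le_generateFrom ?_
        rintro U (hU | ⟨x, hx, rfl⟩)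
        · obtain ⟨V, hV, rfl⟩ := hU
          exact ⟨Subtype.val ⁻¹' V, TopologicalSpace.isOpen_generateFrom_of_mem
            (Or.inl ⟨V, hV, rfl⟩), rfl⟩
        · refine ⟨{⟨x, trivial⟩}, TopologicalSpace.isOpen_generateFrom_of_mem
            (Or.inr ⟨_, hx, rfl⟩), ?_⟩
          ext y
          simp [Subtype.ext_iff]
    · rw [← isOpen_compl_iff, isOpen_isolatingTopology_iff]
      intro x hx hxA
      exact absurd ⟨⟨x, hA hxA⟩, rfl⟩ hx
  exact h.of_isClosedEmbedding hf

/-- The endpoint of an adjoined ray is not in `A`, so the points of `A` in the ray are Euclidean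
interior to it. -/
theorem isolatingTopology_le_leftTopology (X A : Set ℝ) :
    isolatingTopology X A ≤ leftTopology X A := by
  refine le_generateFrom ?_
  rintro U (hU | ⟨x, hx, rfl⟩)
  · exact TopologicalSpace.isOpen_generateFrom_of_mem (Or.inl hU)
  · rw [isOpen_isolatingTopology_iff]
    intro y (hy : (y : ℝ) ≤ x) hyA
    have hlt : (y : ℝ) < x := lt_of_le_of_ne hy fun h => hx (h ▸ hyA)
    exact ⟨x - y, sub_pos.2 hlt, fun z hz => by
      have := (abs_lt.1 hz).2
      show (z : ℝ) ≤ x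
      linarith⟩

theorem isolatingTopology_le_rightTopology (X A : Set ℝ) :
    isolatingTopology X A ≤ rightTopology X A := by
  refine le_generateFrom ?_
  rintro U (hU | ⟨x, hx, rfl⟩)
  · exact TopologicalSpace.isOpen_generateFrom_of_mem (Or.inl hU)
  · rw [isOpen_isolatingTopology_iff]
    intro y (hy : (x : ℝ) ≤ y) hyA
    have hlt : (x : ℝ) < y := lt_of_le_of_ne hy fun h => hx (h ▸ hyA)
    exact ⟨y - x, sub_pos.2 hlt, fun z hz => by
      have := (abs_lt.1 hz).1
      show (x : ℝ) ≤ z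
      linarith⟩

/-! ### Co-non-Archimedean subbases from cuts in the complement -/

/-- If cuts at a dense set of points outside `X` are open, then all Euclidean open sets are. -/
theorem isOpen_of_forall_isOpen_rays {X B : Set ℝ} (hB : Dense B)
    {t : TopologicalSpace X} (hlt : ∀ b ∈ B, IsOpen[t] {y : X | (y : ℝ) < b})
    (hgt : ∀ b ∈ B, IsOpen[t] {y : X | b < (y : ℝ)}) {U : Set X}
    (hU : IsOpen[instTopologicalSpaceSubtype] U) : IsOpen[t] U := by
  refine isOpen_iff_forall_mem_open.2 fun x hx => ?_
  obtain ⟨ε, hε, h⟩ := Metric.isOpen_iff.1 hU x hx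
  obtain ⟨b, hb, hb1, hb2⟩ := hB.exists_between (show (x : ℝ) - ε < x by linarith)
  obtain ⟨c, hc, hc1, hc2⟩ := hB.exists_between (show (x : ℝ) < x + ε by linarith)
  refine ⟨{y : X | b < (y : ℝ)} ∩ {y : X | (y : ℝ) < c}, ?_, (hgt b hb).inter (hlt c hc), hb2, hc1⟩
  rintro y ⟨hy1, hy2⟩
  refine h ?_
  rw [Metric.mem_ball, Subtype.dist_eq, Real.dist_eq, abs_lt]
  simp only [mem_ofPred_eq] at hy1 hy2
  constructor <;> linarith

/-- A family which, with complements, contains the cuts at a dense set of points outside `X` and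
consists otherwise of the sets to be adjoined, whose complements are Euclidean open. -/
theorem adjoinOpens_eq_generateFrom {X B : Set ℝ} (hB : Dense B) (hXB : Disjoint X B)
    {S P : Set (Set X)} (hP : ∀ U ∈ P, IsClosed U)
    (hS : S ⊆ {U | (∃ b ∈ B, U = {y : X | (y : ℝ) < b}) ∨ (∃ b ∈ B, U = {y : X | b < (y : ℝ)})
      ∨ U ∈ P}) (hPS : P ⊆ S)
    (hcut : (∀ b ∈ B, {y : X | (y : ℝ) < b} ∈ S) ∨ ∀ b ∈ B, {y : X | b < (y : ℝ)} ∈ S) :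
    adjoinOpens inferInstance P =
      TopologicalSpace.generateFrom (S ∪ {V : Set X | ∃ U ∈ S, V = Uᶜ}) := by
  have hc1 : ∀ b ∈ B, {y : X | (y : ℝ) < b}ᶜ = {y : X | b < (y : ℝ)} := by
    intro b hb
    ext y
    have : (y : ℝ) ≠ b := fun h => Set.disjoint_left.1 hXB y.2 (h ▸ hb)
    simp only [mem_compl_iff, mem_ofPred_eq, not_lt]
    exact ⟨fun h => lt_of_le_of_ne h this.symm, le_of_lt⟩
  have hc2 : ∀ b ∈ B, {y : X | b < (y : ℝ)}ᶜ = {y : X | (y : ℝ) < b} := fun b hb => by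
    rw [← hc1 b hb, compl_compl]
  have hlt : ∀ b : ℝ, IsOpen {y : X | (y : ℝ) < b} := fun b =>
    isOpen_lt continuous_subtype_val continuous_const
  have hgt : ∀ b : ℝ, IsOpen {y : X | b < (y : ℝ)} := fun b =>
    isOpen_lt continuous_const continuous_subtype_val
  refine le_antisymm (le_generateFrom ?_) (le_generateFrom ?_)
  · rintro V (hV | ⟨U, hU, rfl⟩)
    · rcases hS hV with ⟨b, hb, rfl⟩ | ⟨b, hb, rfl⟩ | h
      · exact TopologicalSpace.isOpen_generateFrom_of_mem (Or.inl (hlt b))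
      · exact TopologicalSpace.isOpen_generateFrom_of_mem (Or.inl (hgt b))
      · exact TopologicalSpace.isOpen_generateFrom_of_mem (Or.inr h)
    · rcases hS hU with ⟨b, hb, rfl⟩ | ⟨b, hb, rfl⟩ | h
      · exact TopologicalSpace.isOpen_generateFrom_of_mem (Or.inl (hc1 b hb ▸ hgt b))
      · exact TopologicalSpace.isOpen_generateFrom_of_mem (Or.inl (hc2 b hb ▸ hlt b))
      · exact TopologicalSpace.isOpen_generateFrom_of_mem (Or.inl (hP U h).isOpen_compl)
  · rintro V (hV | hV)
    · refine isOpen_of_forall_isOpen_rays hB (fun b hb => ?_) (fun b hb => ?_) (U := V) hV <;>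
        refine TopologicalSpace.isOpen_generateFrom_of_mem ?_ <;> rcases hcut with h | h
      · exact Or.inl (h b hb)
      · exact Or.inr ⟨_, h b hb, (hc2 b hb).symm⟩
      · exact Or.inr ⟨_, h b hb, (hc1 b hb).symm⟩
      · exact Or.inl (h b hb)
    · exact TopologicalSpace.isOpen_generateFrom_of_mem (Or.inl (hPS hV))

/-- Lower cuts form a chain, and a singleton is disjoint from or contained in any set. -/
theorem isCoNonArchimedean_isolatingTopology {X A B : Set ℝ} (hB : Dense B)
    (hXB : Disjoint X B) : IsCoNonArchimedean (isolatingTopology X A) := by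
  refine ⟨{U | ∃ b ∈ B, U = {y : X | (y : ℝ) < b}} ∪ {U | ∃ x : X, (x : ℝ) ∉ A ∧ U = {x}}, ?_,
    adjoinOpens_eq_generateFrom hB hXB ?_ ?_ subset_union_right
      (Or.inl fun b hb => Or.inl ⟨b, hb, rfl⟩)⟩
  · have hsing : ∀ (x : X) (V : Set X), Disjoint V {x} ∨ V ⊆ {x} ∨ {x} ⊆ V := by
      intro x V
      by_cases hx : x ∈ V
      · exact Or.inr (Or.inr (by simpa using hx))
      · exact Or.inl (by simpa using hx)
    rintro U (⟨b, -, rfl⟩ | ⟨x, -, rfl⟩) V (⟨c, -, rfl⟩ | ⟨y, -, rfl⟩)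
    · rcases le_total b c with h | h
      · exact Or.inr (Or.inl fun y hy => lt_of_lt_of_le hy h)
      · exact Or.inr (Or.inr fun y hy => lt_of_lt_of_le hy h)
    · exact hsing y _
    · rcases hsing x {y : X | (y : ℝ) < c} with h | h | h
      exacts [Or.inl h.symm, Or.inr (Or.inr h), Or.inr (Or.inl h)]
    · exact hsing y _
  · rintro U ⟨x, -, rfl⟩
    exact isClosed_singleton
  · rintro U (h | h)
    exacts [Or.inl h, Or.inr (Or.inr h)]

/-- All members are lower sets of a linear order, hence form a chain. -/
theorem isCoNonArchimedean_leftTopology {X A B : Set ℝ} (hB : Dense B)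
    (hXB : Disjoint X B) : IsCoNonArchimedean (leftTopology X A) := by
  refine ⟨{U | ∃ b ∈ B, U = {y : X | (y : ℝ) < b}} ∪
    {U | ∃ x : X, (x : ℝ) ∉ A ∧ U = {y : X | (y : ℝ) ≤ x}}, ?_,
    adjoinOpens_eq_generateFrom hB hXB ?_ ?_ subset_union_right
      (Or.inl fun b hb => Or.inl ⟨b, hb, rfl⟩)⟩
  · have hlow : ∀ U ∈ {U | ∃ b ∈ B, U = {y : X | (y : ℝ) < b}} ∪
        {U | ∃ x : X, (x : ℝ) ∉ A ∧ U = {y : X | (y : ℝ) ≤ x}}, IsLowerSet U := by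
      rintro U (⟨b, -, rfl⟩ | ⟨x, -, rfl⟩) u v huv hu
      exacts [lt_of_le_of_lt (Subtype.coe_le_coe.2 huv) hu,
        le_trans (Subtype.coe_le_coe.2 huv) hu]
    exact fun U hU V hV => Or.inr ((hlow U hU).total (hlow V hV))
  · rintro U ⟨x, -, rfl⟩
    exact isClosed_le continuous_subtype_val continuous_const
  · rintro U (h | h)
    exacts [Or.inl h, Or.inr (Or.inr h)]

/-- Here upper cuts at `B` are taken, so that together with the rays they form a chain of upper
sets. -/
theorem isCoNonArchimedean_rightTopology {X A B : Set ℝ} (hB : Dense B)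
    (hXB : Disjoint X B) : IsCoNonArchimedean (rightTopology X A) := by
  refine ⟨{U | ∃ b ∈ B, U = {y : X | b < (y : ℝ)}} ∪
    {U | ∃ x : X, (x : ℝ) ∉ A ∧ U = {y : X | (x : ℝ) ≤ y}}, ?_,
    adjoinOpens_eq_generateFrom hB hXB ?_ ?_ subset_union_right
      (Or.inr fun b hb => Or.inl ⟨b, hb, rfl⟩)⟩
  · have hup : ∀ U ∈ {U | ∃ b ∈ B, U = {y : X | b < (y : ℝ)}} ∪
        {U | ∃ x : X, (x : ℝ) ∉ A ∧ U = {y : X | (x : ℝ) ≤ y}}, IsUpperSet U := by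
      rintro U (⟨b, -, rfl⟩ | ⟨x, -, rfl⟩) u v huv hu
      exacts [lt_of_lt_of_le hu (Subtype.coe_le_coe.2 huv),
        le_trans hu (Subtype.coe_le_coe.2 huv)]
    exact fun U hU V hV => Or.inr ((hup U hU).total (hup V hV))
  · rintro U ⟨x, -, rfl⟩
    exact isClosed_le continuous_const continuous_subtype_val
  · rintro U (h | h)
    exacts [Or.inr (Or.inl h), Or.inr (Or.inr h)]

/-- The conclusions for a set `X` containing `A` and disjoint from `B`. -/
theorem coNonArchimedean_and_lindelof {X A B : Set ℝ} (hAX : A ⊆ X) (hXB : Disjoint X B)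
    (hA : IsLindelofToCountableDegree (isolatingTopology univ A))
    (hB : IsLindelofToCountableDegree (isolatingTopology univ B)) :
    (IsCoNonArchimedean (isolatingTopology X A) ∧
      IsLindelofToCountableDegree (isolatingTopology X A)) ∧
    (IsCoNonArchimedean (leftTopology X A) ∧
      IsLindelofToCountableDegree (leftTopology X A)) ∧
    (IsCoNonArchimedean (rightTopology X A) ∧
      IsLindelofToCountableDegree (rightTopology X A)) := by
  have hd := dense_of_isLindelofToCountableDegree hB
  have hi := isLindelofToCountableDegree_isolating_of_subset hAX hA
  exact ⟨⟨isCoNonArchimedean_isolatingTopology hd hXB, hi⟩,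
    ⟨isCoNonArchimedean_leftTopology hd hXB, hi.mono (isolatingTopology_le_leftTopology X A)⟩,
    ⟨isCoNonArchimedean_rightTopology hd hXB, hi.mono (isolatingTopology_le_rightTopology X A)⟩⟩

/-! ### Construction of the partition -/

theorem exists_nhd_subset_of_isOpen_pi {M : Set ℝ} {U : Set (ℕ → (univ : Set ℝ))}
    (hU : IsOpen[@Pi.topologicalSpace ℕ (fun _ => (univ : Set ℝ))
      fun _ => isolatingTopology univ M] U) {x : ℕ → (univ : Set ℝ)} (hx : x ∈ U) :
    ∃ K : ℕ, ∃ ε > 0, ∀ y : ℕ → (univ : Set ℝ), (∀ n < K, |(y n : ℝ) - x n| < ε ∧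
      ((x n : ℝ) ∉ M → (y n : ℝ) = x n)) → y ∈ U := by
  obtain ⟨I, u, hu, hsub⟩ := (@isOpen_pi_iff _ _ (fun _ => isolatingTopology univ M) U).1 hU x hx
  have hev : ∀ᶠ ε in 𝓝[>] (0 : ℝ), ∀ n ∈ I, ∀ w : (univ : Set ℝ), |(w : ℝ) - x n| < ε →
      ((x n : ℝ) ∉ M → (w : ℝ) = x n) → w ∈ u n := by
    refine (eventually_all_finset I).2 fun n hn => ?_
    obtain ⟨hopen, hmem⟩ := hu n hn
    by_cases hM : (x n : ℝ) ∈ M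
    · obtain ⟨ε, hε, h⟩ := isOpen_isolatingTopology_iff.1 hopen _ hmem hM
      filter_upwards [nhdsWithin_le_nhds (gt_mem_nhds hε)] with δ hδ w hw _
      exact h w (hw.trans hδ)
    · refine Eventually.of_forall fun ε w _ hw => ?_
      rwa [Subtype.ext (hw hM)]
  obtain ⟨ε, hε, hpos⟩ := (hev.and self_mem_nhdsWithin).exists
  refine ⟨I.sup id + 1, ε, hpos, fun y hy => hsub fun n hn => ?_⟩
  have := hy n (Nat.lt_succ_of_le (Finset.le_sup (f := id) hn))
  exact hε n hn _ this.1 this.2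

/-- The codes all of whose fibres are countable. -/
abbrev CountableFibreCode : Type :=
  {g : List Bool → ℕ → ℝ × Bool // ∀ r, {z | r ∈ freeValues g z}.Countable}

/-- The σ-ideal depends on the cover and so on `M`; quantifying over all codes with countable fibres
keeps the requirement on `M` free of this circularity. -/
theorem isLindelofToCountableDegree_of_forall_code {M : Set ℝ}
    (hM : ∀ g : CountableFibreCode, ∃ z, freeValues g.1 z ⊆ M) :
    IsLindelofToCountableDegree (isolatingTopology univ M) := by
  let : TopologicalSpace (univ : Set ℝ) := isolatingTopology univ M
  refine isLindelof_univ_iff.1 (isLindelof_of_countable_subcover fun {κ} U hU hcov => ?_)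
  let lift : (ℕ → ℝ) → ℕ → (univ : Set ℝ) := fun x n => ⟨x n, trivial⟩
  let Small : Set (ℕ → ℝ) → Prop := fun N => ∃ t : Set κ, t.Countable ∧ lift '' N ⊆ ⋃ i ∈ t, U i
  have hS : IsSigmaIdeal Small := by
    refine ⟨fun hst ⟨t, ht, h⟩ => ⟨t, ht, (image_mono hst).trans h⟩, fun {S} hc hs => ?_⟩
    choose! t ht hsub using hs
    refine ⟨⋃ s ∈ S, t s, hc.biUnion ht, ?_⟩
    rintro _ ⟨x, ⟨s, hs, hx⟩, rfl⟩
    obtain ⟨i, hi, hxi⟩ := mem_iUnion₂.1 (hsub s hs ⟨x, hx, rfl⟩)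
    exact mem_iUnion₂.2 ⟨i, mem_biUnion hs hi, hxi⟩
  by_contra hcon
  have h₀ : ¬ Small univ := fun ⟨t, ht, h⟩ =>
    hcon ⟨t, ht, fun x _ => h ⟨fun n => x n, trivial, rfl⟩⟩
  obtain ⟨z, hz⟩ := hM ⟨schemeCode hS h₀, countable_setOf_mem_freeValues_schemeCode hS h₀⟩
  obtain ⟨i, hi⟩ := mem_iUnion.1 (hcov (mem_univ (lift (branchLimit hS h₀ z))))
  obtain ⟨K, ε, hε, h⟩ := exists_nhd_subset_of_isOpen_pi (hU i) hi
  refine not_small_nhd_branchLimit hS h₀ hz K hε ⟨{i}, countable_singleton i, ?_⟩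
  rintro _ ⟨y, hy, rfl⟩
  exact mem_biUnion (mem_singleton i) (h _ hy)

theorem exists_isLindelofPartition_real : ∃ M : ℝ → Set ℝ, IsLindelofPartition M := by
  have hZ : Cardinal.mk (ℕ → Bool) = Cardinal.continuum := by simp
  have hT : Cardinal.mk CountableFibreCode ≤ Cardinal.mk (ℕ → Bool) := by
    rw [hZ]
    refine (Cardinal.mk_subtype_le _).trans ?_
    have h : Cardinal.mk (ℝ × Bool) = Cardinal.continuum := by
      simp [Cardinal.mk_real, Cardinal.continuum_mul_ofNat]
    -- A code is a countable array with entries from a set of size continuum.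
    simp only [← Cardinal.power_def, h, Cardinal.mk_nat, Cardinal.mk_list_eq_aleph0,
      Cardinal.continuum_power_aleph0, le_refl]
  obtain ⟨M, hdisj, hcov, hM⟩ := exists_partition_forall_exists_subset (K := ℝ)
    (hZ ▸ Cardinal.aleph0_lt_continuum) hT (by rw [hZ, Cardinal.mk_real])
    (fun g : CountableFibreCode => freeValues g.1) (fun g => countable_freeValues g.1)
    (fun g => g.2)
  have hL := fun i => isLindelofToCountableDegree_of_forall_code (fun g => hM g i)
  -- Nonemptiness follows from density.
  exact ⟨M, fun i => (dense_of_isLindelofToCountableDegree (hL i)).nonempty, hdisj, hcov, hL⟩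

theorem IsLindelofPartition.comp_equiv {ι κ : Type*} {M : κ → Set ℝ} (hM : IsLindelofPartition M)
    (e : ι ≃ κ) : IsLindelofPartition (M ∘ e) :=
  ⟨fun i => hM.1 (e i), fun _ _ hij => hM.2.1 (e.injective.ne hij),
    (e.surjective.iUnion_comp M).trans hM.2.2.1, fun i => hM.2.2.2 (e i)⟩

theorem propositionp {ι : Type*} (hι : Cardinal.mk ι = Cardinal.continuum) :
    (∃ M : ι → Set ℝ, IsLindelofPartition M) ∧
    ∀ M : ι → Set ℝ, IsLindelofPartition M → ∀ a b : ι, a ≠ b →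
      ∀ A B C L R : Set ℝ, A = M a → B = M b → C = (A ∪ B)ᶜ → L = A ∪ C → R = B ∪ C →
        (IsCoNonArchimedean (isolatingTopology L A) ∧
          IsLindelofToCountableDegree (isolatingTopology L A)) ∧
        (IsCoNonArchimedean (leftTopology L A) ∧
          IsLindelofToCountableDegree (leftTopology L A)) ∧
        (IsCoNonArchimedean (rightTopology L A) ∧
          IsLindelofToCountableDegree (rightTopology L A)) ∧
        (IsCoNonArchimedean (isolatingTopology R B) ∧
          IsLindelofToCountableDegree (isolatingTopology R B)) ∧
        (IsCoNonArchimedean (leftTopology R B) ∧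
          IsLindelofToCountableDegree (leftTopology R B)) ∧
        (IsCoNonArchimedean (rightTopology R B) ∧
          IsLindelofToCountableDegree (rightTopology R B)) := by
  constructor
  · have h : Cardinal.lift.{0} (Cardinal.mk ι) = Cardinal.lift (Cardinal.mk ℝ) := by
      rw [hι, Cardinal.mk_real, Cardinal.lift_continuum, Cardinal.lift_continuum]
    obtain ⟨e⟩ := Cardinal.lift_mk_eq'.1 h
    obtain ⟨M, hM⟩ := exists_isLindelofPartition_real
    exact ⟨M ∘ e, hM.comp_equiv e⟩
  · rintro M hM a b hab A B C L R rfl rfl rfl rfl rfl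
    have hd : Disjoint (M a) (M b) := hM.2.1 hab
    -- The part `M a` supplies the Lindelöf property, and the omitted part `M b` supplies the dense
    -- set of cuts; below the roles are exchanged.
    obtain ⟨h1, h2, h3⟩ := coNonArchimedean_and_lindelof
      (X := M a ∪ (M a ∪ M b)ᶜ) subset_union_left
      (disjoint_union_left.2 ⟨hd, disjoint_compl_left_iff_subset.2 subset_union_right⟩)
      (hM.2.2.2 a) (hM.2.2.2 b)
    obtain ⟨h4, h5, h6⟩ := coNonArchimedean_and_lindelof
      (X := M b ∪ (M a ∪ M b)ᶜ) subset_union_left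
      (disjoint_union_left.2 ⟨hd.symm, disjoint_compl_left_iff_subset.2 subset_union_left⟩)
      (hM.2.2.2 b) (hM.2.2.2 a)
    exact ⟨h1, h2, h3, h4, h5, h6⟩
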